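/- Let $n,p,N_p,T$ be natural numbers, let $\hat A_k\in\mathbb R^{n\times n}$, $\hat B_k\in\mathbb R^{n\times p}$ ($k\ge 0$) and $\sigma_{\hat x},\sigma_{\hat u},\sigma_{\hat w}\ge 0$. Consider $N_p$ independent rollouts of length $T$ of the linear time-varying system $$\hat x^i_{k+1}=\hat A_k\hat x^i_k+\hat B_k\hat u^i_k+\hat w^i_k,\qquad 1\le i\le N_p,\ 0\le k<T,$$ where all the random vectors $\hat x^i_0\sim\mathcal N(0,\sigma_{\hat x}^2I_n)$, $\hat u^i_k\sim\mathcal N(0,\sigma_{\hat u}^2I_p)$, $\hat w^i_k\sim\mathcal N(0,\sigma_{\hat w}^2I_n)$ are mutually independent. Let $\hat z^i_k=\begin{bmatrix}\hat x^i_k\\ \hat u^i_k\end{bmatrix}\in\mathbb R^{n+p}$, $\hat W^i=[\hat w^i_{T-1}\ \cdots\ \hat w^i_0]$, $\hat Z^i=[\hat z^i_{T-1}\ \cdots\ \hat z^i_0]$, $\hat W=[\hat W^1\ \cdots\ \hat W^{N_p}]$, $\hat Z=[\hat Z^1\ \cdots\ \hat Z^{N_p}]$, and, for weights $q_0,\dots,q_{T-1}\ge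 0$, let $\mathcal Q=\mathrm{diag}(q_{T-1},\dots,q_0)$ and $\hat Q=\mathrm{diag}(\mathcal Q,\dots,\mathcal Q)\in\mathbb R^{N_pT\times N_pT}$. Put $\Phi(k,l)=\hat A_{k-1}\hat A_{k-2}\cdots\hat A_l$ for $k>l$, $\Phi(k,k)=I_n$, and $$\hat G_{k+1}=[\Phi(k,1)\hat B_0\ \ \Phi(k,2)\hat B_1\ \cdots\ \Phi(k,k)\hat B_{k-1}],\qquad \hat F_{k+1}=[\Phi(k,1)\ \ \Phi(k,2)\ \cdots\ \Phi(k,k)]$$ for $k\ge1$, with $\hat G_1=0$, $\hat F_1=0$, and let $$\hat\Sigma_k=\begin{bmatrix}\sigma_{\hat u}^2\hat G_{k+1}\hat G_{k+1}^*+\sigma_{\hat w}^2\hat F_{k+1}\hat F_{k+1}^*+\sigma_{\hat x}^2\Phi(k,0)\Phi(k,0)^*&0\\0&\sigma_{\hat u}^2I_p\end{bmatrix}$$ (the covariance matrix of $\hat z^i_k$). Let $\|\cdot\|$ be the spectral norm. Then for every $\delta>0$ (with $\delta\le\frac12$ in the case $T=1$) such that $N_p\ge(4n+2p)\log\frac T\delta$,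 with probability at least $1-\delta$, $$\|\hat W\hat Q\hat Z^*\|\le 4\sigma_{\hat w}\sqrt{N_p(2n+p)\log\frac{9T}\delta}\ \sum_{k=0}^{T-1}q_k\|\hat\Sigma_k^{1/2}\|.$$ -/

import Mathlib

open MeasureTheory ProbabilityTheory Matrix
open scoped Matrix.Norms.L2Operator MatrixOrder

noncomputable section

namespace AuxSysId

/-- The state transition matrix `Φ(k, l) = A_{k-1} A_{k-2} ⋯ A_l` for `k > l`, and `Φ(k, k) = I`. -/
def transition {n : ℕ} (A : ℕ → Matrix (Fin n) (Fin n) ℝ) : ℕ → ℕ → Matrix (Fin n) (Fin n) ℝ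
  | 0, _ => 1
  | k + 1, l => if l ≤ k then A k * transition A k l else 1

/-- The block row `[Φ(k,1) B_0, Φ(k,2) B_1, …, Φ(k,k) B_{k-1}]` with `k` blocks (empty for `k = 0`),
which maps the inputs `u_0, …, u_{k-1}` to their contribution to `x_k`. -/
def inputBlocks {n p : ℕ} (A : ℕ → Matrix (Fin n) (Fin n) ℝ) (B : ℕ → Matrix (Fin n) (Fin p) ℝ)
    (k : ℕ) : Matrix (Fin n) (Fin k × Fin p) ℝ :=
  Matrix.of fun a c => (transition A k (c.1 + 1) * B c.1) a c.2

/-- The block row `[Φ(k,1), Φ(k,2), …, Φ(k,k)]` with `k` blocks (empty for `k = 0`),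
which maps the noises `w_0, …, w_{k-1}` to their contribution to `x_k`. -/
def noiseBlocks {n : ℕ} (A : ℕ → Matrix (Fin n) (Fin n) ℝ)
    (k : ℕ) : Matrix (Fin n) (Fin k × Fin n) ℝ :=
  Matrix.of fun a c => transition A k (c.1 + 1) a c.2

/-- The covariance matrix `Σ_k` of the state-input pair `z_k = (x_k, u_k)`. -/
def covZ {n p : ℕ} (A : ℕ → Matrix (Fin n) (Fin n) ℝ) (B : ℕ → Matrix (Fin n) (Fin p) ℝ)
    (σx σu σw : ℝ) (k : ℕ) : Matrix (Fin n ⊕ Fin p) (Fin n ⊕ Fin p) ℝ :=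
  Matrix.fromBlocks
    (σu ^ 2 • (inputBlocks A B k * (inputBlocks A B k)ᴴ)
      + σw ^ 2 • (noiseBlocks A k * (noiseBlocks A k)ᴴ)
      + σx ^ 2 • (transition A k 0 * (transition A k 0)ᴴ))
    0 0 (σu ^ 2 • (1 : Matrix (Fin p) (Fin p) ℝ))

/-- `Σ_k` is positive semidefinite, so `CFC.sqrt Σ_k` is its positive semidefinite square root. -/
theorem covZ_posSemidef {n p : ℕ} (A : ℕ → Matrix (Fin n) (Fin n) ℝ)
    (B : ℕ → Matrix (Fin n) (Fin p) ℝ) (σx σu σw : ℝ) (k : ℕ) :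
    (covZ A B σx σu σw k).PosSemidef := by
  have h1 : (σu ^ 2 • (inputBlocks A B k * (inputBlocks A B k)ᴴ)
      + σw ^ 2 • (noiseBlocks A k * (noiseBlocks A k)ᴴ)
      + σx ^ 2 • (transition A k 0 * (transition A k 0)ᴴ)).PosSemidef :=
    (((Matrix.posSemidef_self_mul_conjTranspose _).smul (sq_nonneg σu)).add
      ((Matrix.posSemidef_self_mul_conjTranspose _).smul (sq_nonneg σw))).add
      ((Matrix.posSemidef_self_mul_conjTranspose _).smul (sq_nonneg σx))
  have h2 : (σu ^ 2 • (1 : Matrix (Fin p) (Fin p) ℝ)).PosSemidef :=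
    Matrix.PosSemidef.one.smul (sq_nonneg σu)
  refine Matrix.PosSemidef.of_dotProduct_mulVec_nonneg ?_ fun v => ?_
  · exact Matrix.IsHermitian.fromBlocks h1.1 (by simp) h2.1
  · have e1 := h1.dotProduct_mulVec_nonneg (v ∘ Sum.inl)
    have e2 := h2.dotProduct_mulVec_nonneg (v ∘ Sum.inr)
    have := add_nonneg e1 e2
    rw [covZ, Matrix.fromBlocks_mulVec]
    simpa [dotProduct, Fintype.sum_sum_type] using this

/-- Labels of the independent sources of randomness in `N` rollouts of length `T`: the initial
states `x_0^i`, the inputs `u_k^i` and the process noises `w_k^i`, for `i < N` and `k < T`. -/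
inductive Source (N T : ℕ) : Type
  | init (i : Fin N) : Source N T
  | input (i : Fin N) (k : Fin T) : Source N T
  | noise (i : Fin N) (k : Fin T) : Source N T

/-- The dimension of each source of randomness. -/
def Source.dim {N T : ℕ} (n p : ℕ) : Source N T → ℕ
  | .init _ => n
  | .input _ _ => p
  | .noise _ _ => n

/-- The random vector attached to each source of randomness. -/
def Source.vec {N T n p : ℕ} {Ω : Type*}
    (x₀ : Fin N → Ω → EuclideanSpace ℝ (Fin n))
    (u : Fin N → ℕ → Ω → EuclideanSpace ℝ (Fin p))
    (w : Fin N → ℕ → Ω → EuclideanSpace ℝ (Fin n)) :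
    (s : Source N T) → Ω → EuclideanSpace ℝ (Fin (s.dim n p))
  | .init i => x₀ i
  | .input i k => u i k
  | .noise i k => w i k

/-- The probabilistic assumptions on `N` independent rollouts of length `T`:
`x_0^i ∼ 𝒩(0, σx² I_n)`, `u_k^i ∼ 𝒩(0, σu² I_p)`, `w_k^i ∼ 𝒩(0, σw² I_n)`, and all of these random
vectors (over all rollouts `i < N` and times `k < T`) are mutually independent. -/
structure IsRolloutData {N n p : ℕ} {Ω : Type*} [MeasurableSpace Ω] (P : Measure Ω) (T : ℕ)
    (σx σu σw : ℝ)
    (x₀ : Fin N → Ω → EuclideanSpace ℝ (Fin n))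
    (u : Fin N → ℕ → Ω → EuclideanSpace ℝ (Fin p))
    (w : Fin N → ℕ → Ω → EuclideanSpace ℝ (Fin n)) : Prop where
  init_law : ∀ i, HasLaw (x₀ i)
    (multivariateGaussian 0 (σx ^ 2 • (1 : Matrix (Fin n) (Fin n) ℝ))) P
  input_law : ∀ i, ∀ k < T, HasLaw (u i k)
    (multivariateGaussian 0 (σu ^ 2 • (1 : Matrix (Fin p) (Fin p) ℝ))) P
  noise_law : ∀ i, ∀ k < T, HasLaw (w i k)
    (multivariateGaussian 0 (σw ^ 2 • (1 : Matrix (Fin n) (Fin n) ℝ))) P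
  indep : iIndepFun (Source.vec (T := T) x₀ u w) P

/-- The trajectory of `x_{k+1} = A_k x_k + B_k u_k + w_k` started at `x₀`. -/
def state {n p : ℕ} (A : ℕ → Matrix (Fin n) (Fin n) ℝ) (B : ℕ → Matrix (Fin n) (Fin p) ℝ)
    (x₀ : EuclideanSpace ℝ (Fin n)) (u : ℕ → EuclideanSpace ℝ (Fin p))
    (w : ℕ → EuclideanSpace ℝ (Fin n)) : ℕ → (Fin n → ℝ)
  | 0 => x₀.ofLp
  | k + 1 => A k *ᵥ state A B x₀ u w k + B k *ᵥ (u k).ofLp + (w k).ofLp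

/-- The batch noise matrix `W = [W¹ ⋯ W^N]` with `W^i = [w_{T-1}^i ⋯ w_0^i]`; the column `(i, j)`
is the `j`-th column of the `i`-th block (counted from `0`), that is, `w_{T-1-j}^i`. -/
def batchW {N n : ℕ} (T : ℕ) (w : Fin N → ℕ → EuclideanSpace ℝ (Fin n)) :
    Matrix (Fin n) (Fin N × Fin T) ℝ :=
  Matrix.of fun a c => w c.1 (c.2.rev : ℕ) a

/-- The batch data matrix `Z = [Z¹ ⋯ Z^N]` with `Z^i = [z_{T-1}^i ⋯ z_0^i]`, where `z_k^i` stacks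
the state `x_k^i` on top of the input `u_k^i`. -/
def batchZ {N n p : ℕ} (T : ℕ) (A : ℕ → Matrix (Fin n) (Fin n) ℝ)
    (B : ℕ → Matrix (Fin n) (Fin p) ℝ)
    (x₀ : Fin N → EuclideanSpace ℝ (Fin n)) (u : Fin N → ℕ → EuclideanSpace ℝ (Fin p))
    (w : Fin N → ℕ → EuclideanSpace ℝ (Fin n)) : Matrix (Fin n ⊕ Fin p) (Fin N × Fin T) ℝ :=
  Matrix.of fun a c => Sum.elim (state A B (x₀ c.1) (u c.1) (w c.1) (c.2.rev : ℕ))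
    (u c.1 (c.2.rev : ℕ)).ofLp a

/-- The weight matrix `diag(𝒬, …, 𝒬)` with `N` blocks `𝒬 = diag(q_{T-1}, …, q_0)`. -/
def batchQ (N T : ℕ) (q : ℕ → ℝ) : Matrix (Fin N × Fin T) (Fin N × Fin T) ℝ :=
  Matrix.diagonal fun c => q (c.2.rev : ℕ)

end AuxSysId

end

/-!
Writing `Z` for the batch of the `z_k^i`, the product `W Q Zᴴ` is `∑ k, q_k M_k` with
`M_k = ∑ i, w_k^i (z_k^i)ᵀ`. Since `z_k^i` depends on the randomness before time `k` and on `u_k^i`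
only, `w_k^i` and `z_k^i` are independent, and `xᵀ M_k y` is a sum of `N` independent products of
independent centred Gaussians with variances `v = σw² |x|²` and `s = yᵀ Σ_k y`; its moment
generating function is `(1 - t² v s)^(-N/2)`. Chernoff's bound with `t √(v s) = θ` controls each
such form, `1/4`-nets of the two unit balls (at most `9^(2n+p)` pairs of points, and a loss of
`(1 - 1/4)⁻²`) turn this into a bound on `‖M_k‖` with failure probability `δ / T`, and a union bound
over `k` concludes. With `r² = (2n+p) log (9T/δ) / N` the choice `θ = r / √(1 + r²)` works as long
as `r² ≤ 21/10`, which the lower bound on `N` guarantees.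
-/

namespace AuxSysId

section Nets

open Metric
open scoped NNReal

variable {E F : Type*} [NormedAddCommGroup E] [NormedAddCommGroup F]

theorem card_le_of_isSeparated_closedBall [NormedSpace ℝ E] [FiniteDimensional ℝ E] {ε : ℝ≥0}
    (hε : 0 < ε) {s : Finset E} (hs : (s : Set E) ⊆ closedBall 0 1)
    (hsep : IsSeparated ε (s : Set E)) :
    (s.card : ℝ) ≤ (1 + 2 / (ε : ℝ)) ^ Module.finrank ℝ E := by
  borelize E
  let μ : Measure E := Measure.addHaar
  have hε' : (0 : ℝ) < ε := hε
  have hdisj : (s : Set E).PairwiseDisjoint fun c ↦ ball c (ε / 2 : ℝ) := fun c hc d hd hcd ↦ by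
    refine ball_disjoint_ball ?_
    have : (ε : ENNReal) < edist c d := hsep hc hd hcd
    rw [edist_nndist, ENNReal.coe_lt_coe, ← NNReal.coe_lt_coe, coe_nndist] at this
    linarith
  have hsub : ⋃ c ∈ s, ball c (ε / 2 : ℝ) ⊆ ball 0 (1 + ε / 2) :=
    Set.iUnion₂_subset fun c hc ↦ ball_subset_ball' <| by
      linarith [mem_closedBall.1 (hs hc)]
  have hvol : (s.card : ENNReal) * ENNReal.ofReal ((ε / 2) ^ Module.finrank ℝ E) * μ (ball 0 1) ≤
      ENNReal.ofReal ((1 + ε / 2) ^ Module.finrank ℝ E) * μ (ball 0 1) := calc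
    _ = μ (⋃ c ∈ s, ball c (ε / 2 : ℝ)) := by
      rw [measure_biUnion_finset hdisj fun c _ ↦ measurableSet_ball]
      simp only [μ.addHaar_ball_of_pos _ (half_pos hε'), Finset.sum_const, nsmul_eq_mul, mul_assoc]
    _ ≤ μ (ball 0 (1 + ε / 2)) := measure_mono hsub
    _ = _ := μ.addHaar_ball_of_pos _ (by positivity)
  rw [ENNReal.mul_le_mul_iff_left (measure_ball_pos μ 0 one_pos).ne' measure_ball_lt_top.ne] at hvol
  have hcard : (s.card : ℝ) * (ε / 2) ^ Module.finrank ℝ E ≤ (1 + ε / 2) ^ Module.finrank ℝ E := by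
    have := ENNReal.toReal_le_of_le_ofReal (by positivity) hvol
    rwa [ENNReal.toReal_mul, ENNReal.toReal_natCast, ENNReal.toReal_ofReal (by positivity)] at this
  rw [show 1 + 2 / (ε : ℝ) = (1 + ε / 2) / (ε / 2) by field_simp; ring, div_pow]
  exact (le_div_iff₀ (by positivity)).2 hcard

theorem packingNumber_closedBall_le [NormedSpace ℝ E] [FiniteDimensional ℝ E] {ε : ℝ≥0}
    (hε : 0 < ε) :
    packingNumber ε (closedBall (0 : E) 1) ≤
      (⌊(1 + 2 / (ε : ℝ)) ^ Module.finrank ℝ E⌋₊ : ℕ∞) := by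
  refine iSup₂_le fun s hs ↦ iSup_le fun hsep ↦ ?_
  by_contra! hlt
  obtain ⟨t, hts, htcard⟩ := Set.exists_subset_encard_eq (Order.add_one_le_of_lt hlt)
  lift t to Finset E using Set.finite_of_encard_eq_coe htcard
  rw [Set.encard_coe_eq_coe_finsetCard] at htcard
  have hle := Nat.le_floor <|
    card_le_of_isSeparated_closedBall hε (hts.trans hs) (hsep.subset hts)
  have : t.card = ⌊(1 + 2 / (ε : ℝ)) ^ Module.finrank ℝ E⌋₊ + 1 := by exact_mod_cast htcard
  omega

theorem exists_isCover_closedBall_card_le (E : Type*) [NormedAddCommGroup E] [NormedSpace ℝ E]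
    [FiniteDimensional ℝ E] {ε : ℝ≥0} (hε : 0 < ε) :
    ∃ C : Finset E, (C : Set E) ⊆ closedBall 0 1 ∧ IsCover ε (closedBall 0 1) (C : Set E) ∧
      (C.card : ℝ) ≤ (1 + 2 / (ε : ℝ)) ^ Module.finrank ℝ E := by
  have hfin : packingNumber ε (closedBall (0 : E) 1) ≠ ⊤ :=
    ne_top_of_le_ne_top (ENat.natCast_ne_top _) (packingNumber_closedBall_le hε)
  have hsep : IsSeparated ε (maximalSeparatedSet ε (closedBall (0 : E) 1)) :=
    isSeparated_maximalSeparatedSet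
  have hcover := isCover_maximalSeparatedSet hfin
  have hsub : maximalSeparatedSet ε (closedBall (0 : E) 1) ⊆ closedBall 0 1 :=
    maximalSeparatedSet_subset
  generalize hC : maximalSeparatedSet ε (closedBall (0 : E) 1) = C at hsep hcover hsub
  lift C to Finset E using Set.encard_ne_top_iff.1 (hC ▸ encard_maximalSeparatedSet hfin ▸ hfin)
  exact ⟨C, hsub, hcover, card_le_of_isSeparated_closedBall hε hsub hsep⟩

variable [InnerProductSpace ℝ E] [InnerProductSpace ℝ F] {ε : ℝ≥0} {K : ℝ}

theorem norm_le_of_isCover_closedBall {C : Set E} (hC : IsCover ε (closedBall 0 1) C) (hε : ε < 1)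
    {v : E} (h : ∀ c ∈ C, inner ℝ c v ≤ K) : ‖v‖ ≤ K / (1 - ε) := by
  obtain ⟨c, hc, hdist⟩ : ∃ c ∈ C, dist (‖v‖⁻¹ • v) c ≤ ε := by
    simpa using hC.subset_iUnion_closedBall <|
      mem_closedBall_zero_iff.2 (by simpa [norm_smul] using inv_mul_le_one)
  have hself : inner ℝ (‖v‖⁻¹ • v) v = ‖v‖ := by
    rcases eq_or_ne v 0 with rfl | hv
    · simp
    rw [real_inner_smul_left, real_inner_self_eq_norm_sq]
    field_simp
  have hdiff : inner ℝ (‖v‖⁻¹ • v - c) v ≤ ε * ‖v‖ :=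
    (real_inner_le_norm _ _).trans (by rw [← dist_eq_norm]; gcongr)
  rw [inner_sub_left, hself] at hdiff
  rw [le_div_iff₀ (sub_pos.2 (by exact_mod_cast hε))]
  linarith [h c hc]

theorem opNorm_le_of_isCover_closedBall {C : Set E} (hC : IsCover ε (closedBall 0 1) C)
    (hε : ε < 1) {L : E →L[ℝ] F} (h : ∀ c ∈ C, ‖L c‖ ≤ K) : ‖L‖ ≤ K / (1 - ε) := by
  have hK : 0 ≤ K := by
    obtain ⟨c, hc⟩ := hC.nonempty (nonempty_closedBall.2 zero_le_one)
    exact (norm_nonneg _).trans (h c hc)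
  have hbound : ‖L‖ ≤ K + ‖L‖ * ε :=
    L.opNorm_le_of_unit_norm (by positivity) fun x hx ↦ by
      obtain ⟨c, hc, hdist⟩ : ∃ c ∈ C, dist x c ≤ ε := by
        simpa using hC.subset_iUnion_closedBall (mem_closedBall_zero_iff.2 hx.le)
      calc ‖L x‖ = ‖L c + L (x - c)‖ := by rw [← map_add, add_sub_cancel]
        _ ≤ ‖L c‖ + ‖L‖ * ‖x - c‖ := (norm_add_le _ _).trans <| by gcongr; exact L.le_opNorm _
        _ ≤ K + ‖L‖ * ε := by rw [← dist_eq_norm]; gcongr; exact h c hc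
  rw [le_div_iff₀ (sub_pos.2 (by exact_mod_cast hε))]
  linarith

theorem measureReal_lt_norm_le [FiniteDimensional ℝ E] [FiniteDimensional ℝ F] {Ω : Type*}
    [MeasurableSpace Ω] {P : Measure Ω} [IsFiniteMeasure P] {L : Ω → E →L[ℝ] F} {c η : ℝ}
    (hε : 0 < ε) (hε1 : ε < 1)
    (h : ∀ x y, ‖x‖ ≤ 1 → ‖y‖ ≤ 1 → P.real {ω | c < inner ℝ x (L ω y)} ≤ η) :
    P.real {ω | c / (1 - ε) ^ 2 < ‖L ω‖} ≤
      (1 + 2 / (ε : ℝ)) ^ (Module.finrank ℝ E + Module.finrank ℝ F) * η := by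
  obtain ⟨C, hCball, hC, hCcard⟩ := exists_isCover_closedBall_card_le E hε
  obtain ⟨D, hDball, hD, hDcard⟩ := exists_isCover_closedBall_card_le F hε
  have hη : 0 ≤ η := measureReal_nonneg.trans (h 0 0 (by simp) (by simp))
  have hsub : {ω | c / (1 - ε) ^ 2 < ‖L ω‖} ⊆
      ⋃ z ∈ C ×ˢ D, {ω | c < inner ℝ z.2 (L ω z.1)} := fun ω hω ↦ by
    by_contra hnot
    simp only [Set.mem_iUnion, Finset.mem_product, Set.mem_ofPred_eq, not_exists, not_lt]
      at hω hnot
    refine not_le.2 hω ?_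
    rw [pow_two, ← div_div]
    exact opNorm_le_of_isCover_closedBall hC hε1 fun y hy ↦
      norm_le_of_isCover_closedBall hD hε1 fun x hx ↦ hnot (y, x) ⟨hy, hx⟩
  calc P.real {ω | c / (1 - ε) ^ 2 < ‖L ω‖}
      ≤ P.real (⋃ z ∈ C ×ˢ D, {ω | c < inner ℝ z.2 (L ω z.1)}) :=
        measureReal_mono hsub (measure_ne_top P _)
    _ ≤ ∑ z ∈ C ×ˢ D, P.real {ω | c < inner ℝ z.2 (L ω z.1)} := measureReal_biUnion_finset_le _ _
    _ ≤ ∑ _z ∈ C ×ˢ D, η := Finset.sum_le_sum fun z hz ↦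
      h _ _ (mem_closedBall_zero_iff.1 (hDball (Finset.mem_product.1 hz).2))
        (mem_closedBall_zero_iff.1 (hCball (Finset.mem_product.1 hz).1))
    _ = C.card * D.card * η := by rw [Finset.sum_const, Finset.card_product]; simp
    _ ≤ _ := by rw [pow_add]; gcongr

theorem measureReal_lt_l2_opNorm_le {m n Ω : Type*} [Fintype m] [Fintype n] [DecidableEq n]
    [MeasurableSpace Ω] {P : Measure Ω} [IsFiniteMeasure P] {M : Ω → Matrix m n ℝ} {c η : ℝ}
    (hε : 0 < ε) (hε1 : ε < 1)
    (h : ∀ (x : EuclideanSpace ℝ m) (y : EuclideanSpace ℝ n), ‖x‖ ≤ 1 → ‖y‖ ≤ 1 →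
      P.real {ω | c < x.ofLp ⬝ᵥ M ω *ᵥ y.ofLp} ≤ η) :
    P.real {ω | c / (1 - ε) ^ 2 < ‖M ω‖} ≤
      (1 + 2 / (ε : ℝ)) ^ (Fintype.card m + Fintype.card n) * η := by
  have hnet := measureReal_lt_norm_le (P := P) (c := c) (η := η)
    (L := fun ω ↦ (toEuclideanLin.trans LinearMap.toContinuousLinearMap) (M ω)) hε hε1
    fun x y hx hy ↦ by
      simpa [PiLp.inner_apply, dotProduct, mul_comm] using h x y hx hy
  rwa [finrank_euclideanSpace, finrank_euclideanSpace, add_comm (Fintype.card n)] at hnet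

end Nets

section Numerics

theorem log_le_half_sub_inv {p : ℝ} (hp : 1 ≤ p) : Real.log p ≤ (p - p⁻¹) / 2 := by
  rw [← Real.sinh_log (one_pos.trans_le hp)]
  exact Real.self_le_sinh_iff.2 (Real.log_nonneg hp)

theorem log_add_sq_sub_one_le {q : ℝ} (hq : 1 ≤ q) (hq2 : q ^ 2 ≤ 31 / 10) :
    Real.log q + (q ^ 2 - 1) ≤ 9 / 4 * (q - q⁻¹) := by
  obtain ⟨p, hp, rfl⟩ : ∃ p : ℝ, 1 ≤ p ∧ p ^ 2 = q :=
    ⟨√q, Real.one_le_sqrt.2 hq, Real.sq_sqrt (zero_le_one.trans hq)⟩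
  have : 0 < p := one_pos.trans_le hp
  have hlog : Real.log (p ^ 2) ≤ p - p⁻¹ := by
    rw [Real.log_pow]
    push_cast
    linarith [log_le_half_sub_inv hp]
  have hpoly : p ^ 4 + p ≤ 5 / 4 * p ^ 2 + 9 / 4 := by
    have hp3 : p ≤ 133 / 100 := by
      by_contra! h
      nlinarith [pow_le_pow_left₀ (by norm_num) h.le 4]
    nlinarith [mul_nonneg (sub_nonneg.2 hp) (sub_nonneg.2 hp3), sq_nonneg (p ^ 2 - 9 / 5)]
  have hfactor : 9 / 4 * (p ^ 2 - (p ^ 2)⁻¹) - ((p - p⁻¹) + ((p ^ 2) ^ 2 - 1)) =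
      (p ^ 2 - 1) / p ^ 2 * (5 / 4 * p ^ 2 + 9 / 4 - (p ^ 4 + p)) := by
    field_simp
    ring
  have hnonneg : 0 ≤ (p ^ 2 - 1) / p ^ 2 * (5 / 4 * p ^ 2 + 9 / 4 - (p ^ 4 + p)) :=
    mul_nonneg (div_nonneg (sub_nonneg.2 hq) (sq_nonneg p)) (sub_nonneg.2 hpoly)
  linarith

theorem exists_chernoff_parameter {r : ℝ} (hr : 0 ≤ r) (hr2 : r ^ 2 ≤ 21 / 10) :
    ∃ θ : ℝ, 0 ≤ θ ∧ θ < 1 ∧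
      Real.exp (r ^ 2) * (√(1 - θ ^ 2))⁻¹ ≤ Real.exp (9 / 4 * (θ * r)) := by
  set q := √(1 + r ^ 2)
  have hq2 : q ^ 2 = 1 + r ^ 2 := Real.sq_sqrt (by positivity)
  have hq1 : 1 ≤ q := Real.one_le_sqrt.2 (by linarith [sq_nonneg r])
  have hq0 : 0 < q := one_pos.trans_le hq1
  refine ⟨r / q, by positivity, (div_lt_one hq0).2 (Real.lt_sqrt_of_sq_lt (by linarith)), ?_⟩
  have hsqrt : √(1 - (r / q) ^ 2) = q⁻¹ := by
    rw [Real.sqrt_eq_iff_eq_sq _ (by positivity)]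
    · field_simp
      linarith
    · rw [sub_nonneg, div_pow, div_le_one (by positivity)]
      linarith
  have hexp : r / q * r = q - q⁻¹ := by
    field_simp
    linarith
  rw [hsqrt, inv_inv, hexp]
  calc Real.exp (r ^ 2) * q = Real.exp (Real.log q + (q ^ 2 - 1)) := by
        rw [Real.exp_add, Real.exp_log hq0, hq2, add_sub_cancel_left, mul_comm]
    _ ≤ _ := Real.exp_le_exp.2 (log_add_sq_sub_one_le hq1 (by linarith))

theorem log_nine_div_le {ε : ℝ} (hε : 0 < ε) (hε2 : ε ≤ 1 / 2) :
    Real.log (9 / ε) ≤ 21 / 5 * Real.log (1 / ε) := by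
  have h2 : Real.log 2 ≤ Real.log (1 / ε) :=
    Real.log_le_log two_pos (by rw [le_div_iff₀ hε]; linarith)
  have h9 : Real.log 9 ≤ 16 / 5 * Real.log 2 := by
    have h : Real.log (9 ^ 5) ≤ Real.log (2 ^ 16) := Real.log_le_log (by norm_num) (by norm_num)
    rw [Real.log_pow, Real.log_pow] at h
    push_cast at h
    linarith
  have hsplit : Real.log (9 / ε) = Real.log 9 + Real.log (1 / ε) := by
    rw [← Real.log_mul (by norm_num) (by positivity), mul_one_div]
  linarith

/-- Here `9 / 4 = 4 (1 - 1 / 4) ^ 2`, the constant of the final bound less the loss of the nets. -/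
theorem exists_nine_pow_mul_chernoff_le {N D : ℕ} (hD : D ≠ 0) {ε : ℝ} (hε : 0 < ε)
    (hε2 : ε ≤ 1 / 2) (hN : 2 * D * Real.log (1 / ε) ≤ N) :
    ∃ θ : ℝ, 0 ≤ θ ∧ θ < 1 ∧
      9 ^ D * (Real.exp (-(θ * (9 / 4 * √(N * D * Real.log (9 / ε))))) * (√(1 - θ ^ 2))⁻¹ ^ N) ≤
        ε := by
  have hlog : 0 < Real.log (1 / ε) := Real.log_pos (by rw [lt_div_iff₀ hε]; linarith)
  have hlog9 : 0 < Real.log (9 / ε) := Real.log_pos (by rw [lt_div_iff₀ hε]; linarith)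
  have hNpos : (0 : ℝ) < N := lt_of_lt_of_le (by positivity) hN
  set r := √(D * Real.log (9 / ε) / N)
  have hr : r ^ 2 = D * Real.log (9 / ε) / N := Real.sq_sqrt (by positivity)
  have hr2 : r ^ 2 ≤ 21 / 10 := by
    rw [hr, div_le_iff₀ hNpos]
    nlinarith [mul_le_mul_of_nonneg_left (log_nine_div_le hε hε2) D.cast_nonneg]
  have hNr : (N : ℝ) * r ^ 2 = D * Real.log (9 / ε) := by rw [hr]; field_simp
  have hsqrt : √(N * D * Real.log (9 / ε)) = N * r := by
    rw [Real.sqrt_eq_iff_eq_sq (by positivity) (by positivity), mul_pow, sq (N : ℝ), mul_assoc,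
      mul_assoc, hNr]
  obtain ⟨θ, hθ0, hθ1, hθ⟩ := exists_chernoff_parameter (Real.sqrt_nonneg _) hr2
  refine ⟨θ, hθ0, hθ1, ?_⟩
  have hpow : (9 / ε) ^ D * (√(1 - θ ^ 2))⁻¹ ^ N ≤ Real.exp (θ * (9 / 4 * (N * r))) := calc
    (9 / ε) ^ D * (√(1 - θ ^ 2))⁻¹ ^ N = (Real.exp (r ^ 2) * (√(1 - θ ^ 2))⁻¹) ^ N := by
      rw [mul_pow, ← Real.exp_nat_mul, hNr, Real.exp_nat_mul, Real.exp_log (by positivity)]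
    _ ≤ Real.exp (9 / 4 * (θ * r)) ^ N := by gcongr
    _ = Real.exp (θ * (9 / 4 * (N * r))) := by rw [← Real.exp_nat_mul]; ring_nf
  calc
    _ = ε ^ D * ((9 / ε) ^ D * (√(1 - θ ^ 2))⁻¹ ^ N / Real.exp (θ * (9 / 4 * (N * r)))) := by
      rw [hsqrt, Real.exp_neg, div_pow]
      field_simp
    _ ≤ ε ^ D * 1 := by gcongr; exact (div_le_one (Real.exp_pos _)).2 hpow
    _ ≤ ε := by rw [mul_one]; exact pow_le_of_le_one hε.le (by linarith) hD

end Numerics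

section Gaussian
open scoped NNReal

variable {Ω ι κ : Type*} [MeasurableSpace Ω] {P : Measure Ω}

theorem integral_exp_mul_sq_gaussianReal {v : ℝ≥0} {c : ℝ} (hcv : 2 * c * v < 1) :
    ∫ x, Real.exp (c * x ^ 2) ∂gaussianReal 0 v = (√(1 - 2 * c * v))⁻¹ := by
  rcases eq_or_ne v 0 with rfl | hv
  · simp
  have : (0 : ℝ) < v := by positivity
  have hdensity (x : ℝ) : gaussianPDFReal 0 v x • Real.exp (c * x ^ 2) =
      (√(2 * Real.pi * v))⁻¹ * Real.exp (-((1 - 2 * c * v) / (2 * v)) * x ^ 2) := by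
    rw [gaussianPDFReal, smul_eq_mul, mul_assoc, ← Real.exp_add]
    congr 2
    field_simp
    ring
  have : 0 < 1 - 2 * c * v := sub_pos.2 hcv
  rw [integral_gaussianReal_eq_integral_smul hv]
  simp only [hdensity]
  rw [integral_const_mul, integral_gaussian, ← Real.sqrt_inv, ← Real.sqrt_inv,
    ← Real.sqrt_mul (by positivity)]
  congr 1
  field_simp

theorem integrable_exp_mul_sq_gaussianReal {v : ℝ≥0} {c : ℝ} (hcv : 2 * c * v < 1) :
    Integrable (fun x ↦ Real.exp (c * x ^ 2)) (gaussianReal 0 v) :=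
  .of_integral_ne_zero <| by
    rw [integral_exp_mul_sq_gaussianReal hcv]
    exact inv_ne_zero (Real.sqrt_pos.2 (sub_pos.2 hcv)).ne'

theorem mgf_mul_of_gaussianReal [IsFiniteMeasure P] {X Y : Ω → ℝ} {v w : ℝ≥0} (hXY : X ⟂ᵢ[P] Y)
    (hX : HasLaw X (gaussianReal 0 v) P) (hY : HasLaw Y (gaussianReal 0 w) P) {t : ℝ}
    (ht : t ^ 2 * v * w < 1) : mgf (X * Y) P t = (√(1 - t ^ 2 * v * w))⁻¹ := by
  let γ := (gaussianReal 0 v).prod (gaussianReal 0 w)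
  let f : ℝ × ℝ → ℝ := fun z ↦ Real.exp (t * (z.1 * z.2))
  have hinner (x : ℝ) : ∫ y, f (x, y) ∂gaussianReal 0 w = Real.exp (t ^ 2 * w / 2 * x ^ 2) := by
    have := congrFun (mgf_fun_id_gaussianReal (μ := 0) (v := w)) (t * x)
    simp only [mgf, mul_assoc] at this
    simp only [f, this]
    ring_nf
  have ht' : 2 * (t ^ 2 * w / 2) * v < 1 := by linarith
  have hf : Integrable f γ := by
    refine (integrable_prod_iff (by fun_prop)).2 ⟨ae_of_all _ fun x ↦ ?_, ?_⟩
    · simpa only [f, mul_assoc] using integrable_exp_mul_gaussianReal (t * x)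
    · simpa only [Real.norm_eq_abs, f, Real.abs_exp, hinner] using
        integrable_exp_mul_sq_gaussianReal ht'
  calc mgf (X * Y) P t = ∫ z, f z ∂γ :=
        (hXY.hasLaw_prod hX hY).integral_comp (f := f) hf.aestronglyMeasurable
    _ = ∫ x, ∫ y, f (x, y) ∂gaussianReal 0 w ∂gaussianReal 0 v := integral_prod f hf
    _ = (√(1 - t ^ 2 * v * w))⁻¹ := by
      simp only [hinner]
      rw [integral_exp_mul_sq_gaussianReal ht']
      ring_nf

theorem mul_ae_eq_zero_of_gaussianReal {X Y : Ω → ℝ} {v w : ℝ≥0}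
    (hX : HasLaw X (gaussianReal 0 v) P) (hY : HasLaw Y (gaussianReal 0 w) P) (hvw : v * w = 0) :
    X * Y =ᵐ[P] 0 := by
  rcases mul_eq_zero.1 hvw with rfl | rfl
  · filter_upwards [(gaussianReal_zero_var 0 ▸ hX).ae_eq_of_dirac] with ω hω
    simp [hω]
  · filter_upwards [(gaussianReal_zero_var 0 ▸ hY).ae_eq_of_dirac] with ω hω
    simp [hω]

theorem hasLaw_finsetSum_gaussianReal [IsProbabilityMeasure P] {X : ι → Ω → ℝ} {m : ι → ℝ}
    {v : ι → ℝ≥0} (hindep : iIndepFun X P)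
    (hlaw : ∀ i, HasLaw (X i) (gaussianReal (m i) (v i)) P) (s : Finset ι) :
    HasLaw (∑ i ∈ s, X i) (gaussianReal (∑ i ∈ s, m i) (∑ i ∈ s, v i)) P := by
  classical
  have hmeas (i : ι) : AEMeasurable (X i) P := (hlaw i).aemeasurable
  refine ⟨Finset.aemeasurable_sum s fun i _ ↦ hmeas i, ?_⟩
  induction s using Finset.induction_on with
  | empty => simp [Pi.zero_def]
  | insert i s hi ih =>
    rw [Finset.sum_insert hi, Finset.sum_insert hi, Finset.sum_insert hi]
    exact gaussianReal_add_gaussianReal_of_indepFun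
      (hindep.indepFun_finsetSum_of_notMem₀ hmeas hi).symm (hlaw i).map_eq ih

theorem iIndepFun_curry [Countable ι] [Countable κ] [IsProbabilityMeasure P] {β : Type*}
    [MeasurableSpace β] {X : ι × κ → Ω → β} (hX : iIndepFun X P)
    (hmeas : ∀ i, AEMeasurable (X i) P) : iIndepFun (fun i ω j ↦ X (i, j) ω) P := by
  have hprob (p : ι × κ) : IsProbabilityMeasure (P.map (X p)) :=
    Measure.isProbabilityMeasure_map (hmeas p)
  have hrow (i : ι) :
      P.map (fun ω j ↦ X (i, j) ω) = Measure.infinitePi fun j ↦ P.map (X (i, j)) :=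
    (hX.precomp (Prod.mk_right_injective i)).map_fun_eq_infinitePi_map₀' fun j ↦ hmeas (i, j)
  rw [iIndepFun_iff_map_fun_eq_infinitePi_map₀' fun i ↦ aemeasurable_pi_lambda _ fun j ↦
    hmeas (i, j)]
  simp only [hrow]
  rw [← Measure.infinitePi_map_curry, ← hX.map_fun_eq_infinitePi_map₀' hmeas,
    AEMeasurable.map_map_of_aemeasurable]
  · rfl
  · exact (MeasurableEquiv.measurable _).aemeasurable
  · exact aemeasurable_pi_lambda _ hmeas

variable [IsProbabilityMeasure P] [Fintype ι]

theorem mgf_sum_mul_of_gaussianReal {X Y : ι → Ω → ℝ} {v w : ℝ≥0}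
    (hindep : iIndepFun (fun i ↦ X i * Y i) P) (hXY : ∀ i, X i ⟂ᵢ[P] Y i)
    (hX : ∀ i, HasLaw (X i) (gaussianReal 0 v) P) (hY : ∀ i, HasLaw (Y i) (gaussianReal 0 w) P)
    {t : ℝ} (ht : t ^ 2 * v * w < 1) :
    mgf (∑ i, X i * Y i) P t = (√(1 - t ^ 2 * v * w))⁻¹ ^ Fintype.card ι := by
  rw [hindep.mgf_sum₀ fun i ↦ (hX i).aemeasurable.mul (hY i).aemeasurable]
  simp [mgf_mul_of_gaussianReal (hXY _) (hX _) (hY _) ht]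

theorem measureReal_lt_sum_mul_le_exp_mul {X Y : ι → Ω → ℝ} {v w : ℝ≥0}
    (hindep : iIndepFun (fun i ↦ X i * Y i) P) (hXY : ∀ i, X i ⟂ᵢ[P] Y i)
    (hX : ∀ i, HasLaw (X i) (gaussianReal 0 v) P) (hY : ∀ i, HasLaw (Y i) (gaussianReal 0 w) P)
    {θ τ : ℝ} (hθ0 : 0 ≤ θ) (hθ1 : θ < 1) :
    P.real {ω | √(v * w) * τ < ∑ i, X i ω * Y i ω} ≤
      Real.exp (-(θ * τ)) * (√(1 - θ ^ 2))⁻¹ ^ Fintype.card ι := by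
  by_cases hvw : (v * w : ℝ) = 0
  · have hnull : P.real {ω | √(v * w) * τ < ∑ i, X i ω * Y i ω} = 0 := by
      rw [measureReal_eq_zero_iff, measure_eq_zero_iff_ae_notMem]
      filter_upwards [ae_all_iff.2 fun i ↦
        mul_ae_eq_zero_of_gaussianReal (hX i) (hY i) (by exact_mod_cast hvw)] with ω hω
      have hω' (i : ι) : X i ω * Y i ω = 0 := hω i
      simp [hω', hvw]
    rw [hnull]
    positivity
  have : 0 < √(v * w : ℝ) := by positivity
  have hθ2 : 0 < 1 - θ ^ 2 := by nlinarith
  set t := θ / √(v * w : ℝ) with ht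
  have ht2 : t ^ 2 * v * w = θ ^ 2 := by
    rw [mul_assoc, ht, div_pow, Real.sq_sqrt (by positivity), div_mul_cancel₀ _ hvw]
  have hmgf := mgf_sum_mul_of_gaussianReal hindep hXY hX hY (t := t) (by linarith)
  rw [ht2] at hmgf
  have hintegrable : Integrable (fun ω ↦ Real.exp (t * (∑ i, X i * Y i) ω)) P :=
    .of_integral_ne_zero <| ne_of_gt <| by
      change 0 < mgf _ P t
      rw [hmgf]
      positivity
  calc P.real {ω | √(v * w) * τ < ∑ i, X i ω * Y i ω}
      ≤ P.real {ω | √(v * w) * τ ≤ (∑ i, X i * Y i) ω} :=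
        measureReal_mono fun ω hω ↦ by
          simpa only [Set.mem_ofPred_eq, Finset.sum_apply, Pi.mul_apply] using le_of_lt hω
    _ ≤ Real.exp (-t * (√(v * w) * τ)) * mgf (∑ i, X i * Y i) P t :=
      measure_ge_le_exp_mul_mgf _ (by positivity) hintegrable
    _ = _ := by
      rw [hmgf, ht]
      congr 2
      field_simp

theorem measureReal_lt_sum_mul_sum_le_exp_mul [Fintype κ] {Y : ι × Option κ → Ω → ℝ} {v w : ℝ≥0}
    (hindep : iIndepFun Y P) (hmeas : ∀ c, AEMeasurable (Y c) P)
    (hnone : ∀ i, HasLaw (Y (i, none)) (gaussianReal 0 v) P)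
    (hsome : ∀ i, HasLaw (fun ω ↦ ∑ j, Y (i, some j) ω) (gaussianReal 0 w) P)
    {θ τ : ℝ} (hθ0 : 0 ≤ θ) (hθ1 : θ < 1) :
    P.real {ω | √(v * w) * τ < ∑ i, Y (i, none) ω * ∑ j, Y (i, some j) ω} ≤
      Real.exp (-(θ * τ)) * (√(1 - θ ^ 2))⁻¹ ^ Fintype.card ι := by
  refine measureReal_lt_sum_mul_le_exp_mul ?_ (fun i ↦ ?_) hnone hsome hθ0 hθ1
  · exact (iIndepFun_curry hindep hmeas).comp (fun _ z ↦ z none * ∑ j, z (some j))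
      fun _ ↦ by fun_prop
  · have hrow : iIndepFun (fun j ↦ Y (i, j)) P := hindep.precomp (Prod.mk_right_injective i)
    have hsplit := hrow.indepFun_finsetSum_of_notMem₀ (fun j ↦ hmeas (i, j))
      (s := Finset.univ.map Function.Embedding.some) (i := none) (by simp)
    rw [Finset.sum_map, Finset.sum_fn] at hsplit
    exact hsplit.symm

end Gaussian

section LinearSystem

variable {n p : ℕ} (A : ℕ → Matrix (Fin n) (Fin n) ℝ) (B : ℕ → Matrix (Fin n) (Fin p) ℝ)

theorem transition_self (k : ℕ) : transition A k k = 1 := by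
  cases k <;> simp [transition]

theorem transition_succ {k l : ℕ} (h : l ≤ k) :
    transition A (k + 1) l = A k * transition A k l := by
  simp [transition, h]

/-- The state-input pair `z_k = (x_k, u_k)` of a single rollout. -/
def stateInput (x₀ : EuclideanSpace ℝ (Fin n)) (u : ℕ → EuclideanSpace ℝ (Fin p))
    (w : ℕ → EuclideanSpace ℝ (Fin n)) (k : ℕ) : Fin n ⊕ Fin p → ℝ :=
  Sum.elim (state A B x₀ u w k) (u k).ofLp

theorem state_eq_transition (x₀ : EuclideanSpace ℝ (Fin n)) (u : ℕ → EuclideanSpace ℝ (Fin p))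
    (w : ℕ → EuclideanSpace ℝ (Fin n)) (k : ℕ) :
    state A B x₀ u w k = transition A k 0 *ᵥ x₀.ofLp
      + ∑ l : Fin k, (transition A k (l + 1) * B l) *ᵥ (u l).ofLp
      + ∑ l : Fin k, transition A k (l + 1) *ᵥ (w l).ofLp := by
  induction k with
  | zero => simp [state, transition]
  | succ k ih =>
    have hstep (l : Fin k) : transition A (k + 1) (l + 1) = A k * transition A k (l + 1) :=
      transition_succ A l.2
    simp only [Fin.sum_univ_castSucc, Fin.val_castSucc, Fin.val_last, transition_self, hstep,
      transition_succ A (Nat.zero_le k), state, ih, mulVec_add, mulVec_sum, mulVec_mulVec,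
      Matrix.mul_assoc, Matrix.one_mul, one_mulVec]
    abel

theorem dotProduct_stateInput (x₀ : EuclideanSpace ℝ (Fin n)) (u : ℕ → EuclideanSpace ℝ (Fin p))
    (w : ℕ → EuclideanSpace ℝ (Fin n)) (k : ℕ) (y : Fin n ⊕ Fin p → ℝ) :
    y ⬝ᵥ stateInput A B x₀ u w k =
      (y ∘ Sum.inl ᵥ* transition A k 0) ⬝ᵥ x₀.ofLp + (y ∘ Sum.inr ⬝ᵥ (u k).ofLp
      + (∑ l : Fin k, (y ∘ Sum.inl ᵥ* (transition A k (l + 1) * B l)) ⬝ᵥ (u l).ofLp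
      + ∑ l : Fin k, (y ∘ Sum.inl ᵥ* transition A k (l + 1)) ⬝ᵥ (w l).ofLp)) := by
  have hsplit : y ⬝ᵥ stateInput A B x₀ u w k =
      y ∘ Sum.inl ⬝ᵥ state A B x₀ u w k + y ∘ Sum.inr ⬝ᵥ (u k).ofLp := by
    simp [stateInput, dotProduct]
  rw [hsplit, state_eq_transition]
  simp only [dotProduct_add, dotProduct_sum, dotProduct_mulVec]
  ring

theorem dotProduct_mul_conjTranspose_mulVec {m l : Type*} [Fintype m] [Fintype l]
    (M : Matrix m l ℝ) (y : m → ℝ) : y ⬝ᵥ (M * Mᴴ) *ᵥ y = (y ᵥ* M) ⬝ᵥ (y ᵥ* M) := by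
  rw [← mulVec_mulVec, dotProduct_mulVec, conjTranspose_eq_transpose_of_trivial, mulVec_transpose]

theorem dotProduct_covZ_mulVec (σx σu σw : ℝ) (k : ℕ) (y : Fin n ⊕ Fin p → ℝ) :
    y ⬝ᵥ covZ A B σx σu σw k *ᵥ y =
      σx ^ 2 * ((y ∘ Sum.inl ᵥ* transition A k 0) ⬝ᵥ (y ∘ Sum.inl ᵥ* transition A k 0))
      + (σu ^ 2 * (y ∘ Sum.inr ⬝ᵥ y ∘ Sum.inr)
      + (∑ l : Fin k, σu ^ 2 * ((y ∘ Sum.inl ᵥ* (transition A k (l + 1) * B l)) ⬝ᵥ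
          (y ∘ Sum.inl ᵥ* (transition A k (l + 1) * B l)))
      + ∑ l : Fin k, σw ^ 2 * ((y ∘ Sum.inl ᵥ* transition A k (l + 1)) ⬝ᵥ
          (y ∘ Sum.inl ᵥ* transition A k (l + 1))))) := by
  have hblocks : y ⬝ᵥ covZ A B σx σu σw k *ᵥ y =
      y ∘ Sum.inl ⬝ᵥ (σu ^ 2 • (inputBlocks A B k * (inputBlocks A B k)ᴴ)
        + σw ^ 2 • (noiseBlocks A k * (noiseBlocks A k)ᴴ)
        + σx ^ 2 • (transition A k 0 * (transition A k 0)ᴴ)) *ᵥ (y ∘ Sum.inl)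
      + y ∘ Sum.inr ⬝ᵥ (σu ^ 2 • (1 : Matrix (Fin p) (Fin p) ℝ)) *ᵥ (y ∘ Sum.inr) := by
    rw [covZ, fromBlocks_mulVec]
    simp [dotProduct]
  have hinput : (y ∘ Sum.inl ᵥ* inputBlocks A B k) ⬝ᵥ (y ∘ Sum.inl ᵥ* inputBlocks A B k) =
      ∑ l : Fin k, (y ∘ Sum.inl ᵥ* (transition A k (l + 1) * B l)) ⬝ᵥ
        (y ∘ Sum.inl ᵥ* (transition A k (l + 1) * B l)) := Fintype.sum_prod_type _
  have hnoise : (y ∘ Sum.inl ᵥ* noiseBlocks A k) ⬝ᵥ (y ∘ Sum.inl ᵥ* noiseBlocks A k) =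
      ∑ l : Fin k, (y ∘ Sum.inl ᵥ* transition A k (l + 1)) ⬝ᵥ
        (y ∘ Sum.inl ᵥ* transition A k (l + 1)) := Fintype.sum_prod_type _
  rw [hblocks]
  simp only [add_mulVec, smul_mulVec, dotProduct_add, dotProduct_smul,
    dotProduct_mul_conjTranspose_mulVec, hinput, hnoise, one_mulVec, smul_eq_mul, Finset.mul_sum]
  ring

theorem dotProduct_mulVec_le_norm_sqrt_sq {m : Type*} [Fintype m] [DecidableEq m]
    {S : Matrix m m ℝ} (hS : S.PosSemidef) (y : EuclideanSpace ℝ m) :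
    y.ofLp ⬝ᵥ S *ᵥ y.ofLp ≤ ‖CFC.sqrt S‖ ^ 2 * ‖y‖ ^ 2 := by
  have hself : (CFC.sqrt S)ᴴ = CFC.sqrt S := (CFC.sqrt_nonneg S).isSelfAdjoint
  have hmul : CFC.sqrt S * (CFC.sqrt S)ᴴ = S := hself.symm ▸ CFC.sqrt_mul_sqrt_self S hS.nonneg
  calc y.ofLp ⬝ᵥ S *ᵥ y.ofLp = ‖WithLp.toLp 2 ((CFC.sqrt S)ᴴ *ᵥ y.ofLp)‖ ^ 2 := by
        conv_lhs => rw [← hmul]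
        rw [dotProduct_mul_conjTranspose_mulVec, EuclideanSpace.real_norm_sq_eq,
          conjTranspose_eq_transpose_of_trivial, mulVec_transpose]
        simp [dotProduct, sq]
    _ ≤ (‖(CFC.sqrt S)ᴴ‖ * ‖y‖) ^ 2 := by gcongr; exact l2_opNorm_mulVec _ y
    _ = _ := by rw [hself, mul_pow]

variable {N : ℕ} (x₀ : Fin N → EuclideanSpace ℝ (Fin n)) (u : Fin N → ℕ → EuclideanSpace ℝ (Fin p))
  (w : Fin N → ℕ → EuclideanSpace ℝ (Fin n))

/-- The cross moment `∑ i, w_k^i (z_k^i)ᵀ` of the noise and the state-input pair at time `k`. -/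
def crossMoment (k : ℕ) : Matrix (Fin n) (Fin n ⊕ Fin p) ℝ :=
  ∑ i, vecMulVec (w i k).ofLp (stateInput A B (x₀ i) (u i) (w i) k)

theorem dotProduct_crossMoment_mulVec (x : Fin n → ℝ) (y : Fin n ⊕ Fin p → ℝ) (k : ℕ) :
    x ⬝ᵥ crossMoment A B x₀ u w k *ᵥ y =
      ∑ i, (x ⬝ᵥ (w i k).ofLp) * (y ⬝ᵥ stateInput A B (x₀ i) (u i) (w i) k) := by
  simp only [crossMoment, Matrix.sum_mulVec, dotProduct_sum, vecMulVec_mulVec, op_smul_eq_smul,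
    dotProduct_smul, smul_eq_mul, dotProduct_comm y, mul_comm]

theorem batchW_mul_batchQ_mul_batchZ (T : ℕ) (q : ℕ → ℝ) :
    batchW T w * batchQ N T q * (batchZ T A B x₀ u w)ᴴ =
      ∑ k : Fin T, q k • crossMoment A B x₀ u w k := by
  rw [← Equiv.sum_comp Fin.revPerm]
  ext a b
  rw [mul_apply, batchQ]
  simp only [mul_diagonal, Matrix.sum_apply, Matrix.smul_apply, crossMoment,
    Fintype.sum_prod_type, conjTranspose_apply, batchW, batchZ, of_apply, star_trivial,
    Fin.revPerm_apply, vecMulVec_apply, smul_eq_mul, stateInput, Finset.mul_sum]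
  rw [Finset.sum_comm]
  refine Finset.sum_congr rfl fun k _ ↦ Finset.sum_congr rfl fun i _ ↦ ?_
  ring

theorem norm_batchW_mul_batchQ_mul_batchZ_le {T : ℕ} {q b : ℕ → ℝ} {c : ℝ}
    (hq : ∀ k < T, 0 ≤ q k) (h : ∀ k : Fin T, ‖crossMoment A B x₀ u w k‖ ≤ c * b k) :
    ‖batchW T w * batchQ N T q * (batchZ T A B x₀ u w)ᴴ‖ ≤
      c * ∑ k ∈ Finset.range T, q k * b k := by
  rw [batchW_mul_batchQ_mul_batchZ, ← Fin.sum_univ_eq_sum_range (fun k ↦ q k * b k),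
    Finset.mul_sum]
  refine (norm_sum_le _ _).trans (Finset.sum_le_sum fun k _ ↦ ?_)
  rw [norm_smul, Real.norm_of_nonneg (hq k k.2), mul_left_comm]
  exact mul_le_mul_of_nonneg_left (h k) (hq k k.2)

end LinearSystem

section Gaussianity

variable {Ω : Type*} [MeasurableSpace Ω] {P : Measure Ω}

theorem hasLaw_dotProduct_multivariateGaussian {ι : Type*} [Fintype ι] [DecidableEq ι]
    {μ : EuclideanSpace ℝ ι} {S : Matrix ι ι ℝ} (hS : S.PosSemidef) {X : Ω → EuclideanSpace ℝ ι}
    (hX : HasLaw X (multivariateGaussian μ S) P) (c : ι → ℝ) :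
    HasLaw (fun ω ↦ c ⬝ᵥ (X ω).ofLp) (gaussianReal (c ⬝ᵥ μ.ofLp) (c ⬝ᵥ S *ᵥ c).toNNReal) P := by
  have hinner (z : EuclideanSpace ℝ ι) : c ⬝ᵥ z.ofLp = innerSL ℝ (WithLp.toLp 2 c) z := by
    simp [PiLp.inner_apply, dotProduct, mul_comm]
  have hmean : ∫ z, innerSL ℝ (WithLp.toLp 2 c) z ∂multivariateGaussian μ S = c ⬝ᵥ μ.ofLp :=
    (ContinuousLinearMap.integral_comp_id_comm IsGaussian.integrable_id _).trans <| by
      rw [integral_id_multivariateGaussian, hinner]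
  have hvar : Var[innerSL ℝ (WithLp.toLp 2 c); multivariateGaussian μ S] = c ⬝ᵥ S *ᵥ c := by
    have h := covarianceBilin_multivariateGaussian (μ := μ) hS (WithLp.toLp 2 c) (WithLp.toLp 2 c)
    rwa [covarianceBilin_self IsGaussian.memLp_two_id] at h
  have hlaw : HasLaw (innerSL ℝ (WithLp.toLp 2 c))
      (gaussianReal (c ⬝ᵥ μ.ofLp) (c ⬝ᵥ S *ᵥ c).toNNReal) (multivariateGaussian μ S) :=
    ⟨by fun_prop, by rw [IsGaussian.map_eq_gaussianReal, hmean, hvar]⟩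
  simpa only [Function.comp_def, ← hinner] using hlaw.comp hX

end Gaussianity

section Rollouts

variable {n p N T : ℕ} {Ω : Type*} (A : ℕ → Matrix (Fin n) (Fin n) ℝ)
  (B : ℕ → Matrix (Fin n) (Fin p) ℝ) (x₀ : Fin N → Ω → EuclideanSpace ℝ (Fin n))
  (u : Fin N → ℕ → Ω → EuclideanSpace ℝ (Fin p)) (w : Fin N → ℕ → Ω → EuclideanSpace ℝ (Fin n))

/-- Labels of the sources of randomness on which `z_k` depends within one rollout: the initial
state, the input at time `k`, the inputs before time `k` and the noises before time `k`. -/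
abbrev PastIndex (k : ℕ) : Type := Unit ⊕ Unit ⊕ Fin k ⊕ Fin k

/-- The source of randomness of rollout `i` with a given label, where `none` labels `w_k`. -/
def termSource (k : Fin T) : Fin N × Option (PastIndex k) → Source N T
  | (i, none) => .noise i k
  | (i, some (.inl _)) => .init i
  | (i, some (.inr (.inl _))) => .input i k
  | (i, some (.inr (.inr (.inl l)))) => .input i ⟨l, l.2.trans k.2⟩
  | (i, some (.inr (.inr (.inr l)))) => .noise i ⟨l, l.2.trans k.2⟩

theorem termSource_injective (k : Fin T) : Function.Injective (termSource (N := N) k) := by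
  rintro ⟨i, _ | _ | _ | l | l⟩ ⟨j, _ | _ | _ | m | m⟩ h <;>
    simp_all only [termSource, Source.noise.injEq, Source.init.injEq, Source.input.injEq,
      reduceCtorEq, Fin.ext_iff]
  all_goals grind

/-- The coefficients of `x ⬝ᵥ w_k` (at `none`) and of `y ⬝ᵥ z_k` (at the labels `some j`) with
respect to the sources of randomness. -/
def termCoeff (x : Fin n → ℝ) (y : Fin n ⊕ Fin p → ℝ) (k : Fin T) :
    (c : Fin N × Option (PastIndex k)) → Fin ((termSource k c).dim n p) → ℝ
  | (_, none) => x
  | (_, some (.inl _)) => y ∘ Sum.inl ᵥ* transition A k 0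
  | (_, some (.inr (.inl _))) => y ∘ Sum.inr
  | (_, some (.inr (.inr (.inl l)))) => y ∘ Sum.inl ᵥ* (transition A k (l + 1) * B l)
  | (_, some (.inr (.inr (.inr l)))) => y ∘ Sum.inl ᵥ* transition A k (l + 1)

/-- The independent Gaussian summands of `x ⬝ᵥ w_k^i` (at `(i, none)`) and of `y ⬝ᵥ z_k^i` (at
`(i, some j)`). -/
def gaussianTerm (x : Fin n → ℝ) (y : Fin n ⊕ Fin p → ℝ) (k : Fin T)
    (c : Fin N × Option (PastIndex k)) (ω : Ω) : ℝ :=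
  termCoeff A B x y k c ⬝ᵥ (Source.vec x₀ u w (termSource k c) ω).ofLp

theorem sum_gaussianTerm_some (x : Fin n → ℝ) (y : Fin n ⊕ Fin p → ℝ) (k : Fin T) (i : Fin N)
    (ω : Ω) : ∑ j, gaussianTerm A B x₀ u w x y k (i, some j) ω =
      y ⬝ᵥ stateInput A B (x₀ i ω) (u i · ω) (w i · ω) k := by
  rw [dotProduct_stateInput]
  simp only [Fintype.sum_sum_type, Finset.univ_unique, Finset.sum_singleton]
  rfl

/-- The standard deviation of the coordinates of each source of randomness. -/
def Source.std (σx σu σw : ℝ) : Source N T → ℝ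
  | .init _ => σx
  | .input _ _ => σu
  | .noise _ _ => σw

theorem sum_std_sq_mul_dotProduct_termCoeff (σx σu σw : ℝ) (x : Fin n → ℝ)
    (y : Fin n ⊕ Fin p → ℝ) (k : Fin T) (i : Fin N) :
    ∑ j, (termSource k (i, some j)).std σx σu σw ^ 2 *
        (termCoeff A B x y k (i, some j) ⬝ᵥ termCoeff A B x y k (i, some j)) =
      y ⬝ᵥ covZ A B σx σu σw k *ᵥ y := by
  rw [dotProduct_covZ_mulVec]
  simp only [Fintype.sum_sum_type, Finset.univ_unique, Finset.sum_singleton]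
  rfl

theorem sqrt_variance_mul_variance_le (σx σu : ℝ) {σw : ℝ} (hσw : 0 ≤ σw) (k : ℕ)
    {x : EuclideanSpace ℝ (Fin n)} (hx : ‖x‖ ≤ 1) {y : EuclideanSpace ℝ (Fin n ⊕ Fin p)}
    (hy : ‖y‖ ≤ 1) :
    √(σw ^ 2 * (x.ofLp ⬝ᵥ x.ofLp) * (y.ofLp ⬝ᵥ covZ A B σx σu σw k *ᵥ y.ofLp)) ≤
      σw * ‖CFC.sqrt (covZ A B σx σu σw k)‖ := by
  have hx1 : x.ofLp ⬝ᵥ x.ofLp ≤ 1 := by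
    have : x.ofLp ⬝ᵥ x.ofLp = ‖x‖ ^ 2 := by
      rw [EuclideanSpace.real_norm_sq_eq]
      simp only [dotProduct, sq]
    exact this ▸ pow_le_one₀ (norm_nonneg _) hx
  have hy1 : y.ofLp ⬝ᵥ covZ A B σx σu σw k *ᵥ y.ofLp ≤ ‖CFC.sqrt (covZ A B σx σu σw k)‖ ^ 2 :=
    (dotProduct_mulVec_le_norm_sqrt_sq (covZ_posSemidef A B σx σu σw k) y).trans <|
      mul_le_of_le_one_right (sq_nonneg _) (pow_le_one₀ (norm_nonneg _) hy)
  refine Real.sqrt_le_iff.2 ⟨by positivity, ?_⟩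
  rw [mul_pow]
  exact mul_le_mul (mul_le_of_le_one_right (sq_nonneg _) hx1) hy1
    ((covZ_posSemidef A B σx σu σw k).dotProduct_mulVec_nonneg y.ofLp) (sq_nonneg _)

variable [MeasurableSpace Ω] {P : Measure Ω} {σx σu σw : ℝ}
  {x₀ : Fin N → Ω → EuclideanSpace ℝ (Fin n)} {u : Fin N → ℕ → Ω → EuclideanSpace ℝ (Fin p)}
  {w : Fin N → ℕ → Ω → EuclideanSpace ℝ (Fin n)} (hdata : IsRolloutData P T σx σu σw x₀ u w)
include hdata

theorem hasLaw_vec (s : Source N T) : HasLaw (Source.vec x₀ u w s)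
    (multivariateGaussian 0 (s.std σx σu σw ^ 2 • 1)) P := by
  rcases s with i | ⟨i, k⟩ | ⟨i, k⟩
  · exact hdata.init_law i
  · exact hdata.input_law i k k.2
  · exact hdata.noise_law i k k.2

theorem hasLaw_gaussianTerm (x : Fin n → ℝ) (y : Fin n ⊕ Fin p → ℝ) (k : Fin T)
    (c : Fin N × Option (PastIndex k)) :
    HasLaw (gaussianTerm A B x₀ u w x y k c) (gaussianReal 0
      ((termSource k c).std σx σu σw ^ 2 *
        (termCoeff A B x y k c ⬝ᵥ termCoeff A B x y k c)).toNNReal) P := by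
  have hlaw := hasLaw_dotProduct_multivariateGaussian
    (PosSemidef.one.smul (sq_nonneg _)) (hasLaw_vec hdata (termSource k c)) (termCoeff A B x y k c)
  simp only [smul_mulVec, one_mulVec, dotProduct_smul, smul_eq_mul, WithLp.ofLp_zero,
    dotProduct_zero] at hlaw
  exact hlaw

theorem iIndepFun_gaussianTerm (x : Fin n → ℝ) (y : Fin n ⊕ Fin p → ℝ) (k : Fin T) :
    iIndepFun (gaussianTerm A B x₀ u w x y k) P :=
  (hdata.indep.precomp (termSource_injective k)).comp₀
    (fun c z ↦ termCoeff A B x y k c ⬝ᵥ z.ofLp) (fun _ ↦ (hasLaw_vec hdata _).aemeasurable)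
    fun _ ↦ by unfold dotProduct; fun_prop

theorem hasLaw_dotProduct_stateInput [IsProbabilityMeasure P] (y : Fin n ⊕ Fin p → ℝ) (k : Fin T)
    (i : Fin N) :
    HasLaw (fun ω ↦ y ⬝ᵥ stateInput A B (x₀ i ω) (u i · ω) (w i · ω) k)
      (gaussianReal 0 (y ⬝ᵥ covZ A B σx σu σw k *ᵥ y).toNNReal) P := by
  have hindep := (iIndepFun_gaussianTerm A B hdata 0 y k).precomp
    ((Prod.mk_right_injective i).comp (Option.some_injective _))
  have hsum := hasLaw_finsetSum_gaussianReal hindep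
    (fun j ↦ hasLaw_gaussianTerm A B hdata 0 y k (i, some j)) Finset.univ
  have hvar := Real.toNNReal_sum_of_nonneg (s := Finset.univ) fun j _ ↦
    mul_nonneg (sq_nonneg ((termSource k (i, some j)).std σx σu σw))
      (dotProduct_self_star_nonneg (termCoeff A B 0 y k (i, some j)))
  simp only [star_trivial, sum_std_sq_mul_dotProduct_termCoeff] at hvar
  rw [← hvar, Finset.sum_const_zero, Finset.sum_fn] at hsum
  simpa only [Function.comp_apply, sum_gaussianTerm_some] using hsum

theorem measureReal_lt_dotProduct_crossMoment_mulVec_le [IsProbabilityMeasure P] (x : Fin n → ℝ)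
    (y : Fin n ⊕ Fin p → ℝ) (k : Fin T) {θ τ : ℝ} (hθ0 : 0 ≤ θ) (hθ1 : θ < 1) :
    P.real {ω | √(σw ^ 2 * (x ⬝ᵥ x) * (y ⬝ᵥ covZ A B σx σu σw k *ᵥ y)) * τ <
        x ⬝ᵥ crossMoment A B (x₀ · ω) (u · · ω) (w · · ω) k *ᵥ y} ≤
      Real.exp (-(θ * τ)) * (√(1 - θ ^ 2))⁻¹ ^ N := by
  have hx : 0 ≤ σw ^ 2 * (x ⬝ᵥ x) := mul_nonneg (sq_nonneg _) (dotProduct_self_star_nonneg x)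
  have hy : 0 ≤ y ⬝ᵥ covZ A B σx σu σw k *ᵥ y :=
    (covZ_posSemidef A B σx σu σw k).dotProduct_mulVec_nonneg y
  have htail := measureReal_lt_sum_mul_sum_le_exp_mul (τ := τ)
    (v := (σw ^ 2 * (x ⬝ᵥ x)).toNNReal) (iIndepFun_gaussianTerm A B hdata x y k)
    (fun c ↦ (hasLaw_gaussianTerm A B hdata x y k c).aemeasurable)
    (fun i ↦ hasLaw_gaussianTerm A B hdata x y k (i, none))
    (fun i ↦ by
      simpa only [sum_gaussianTerm_some] using hasLaw_dotProduct_stateInput A B hdata y k i)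
    hθ0 hθ1
  simp only [Real.coe_toNNReal _ hx, Real.coe_toNNReal _ hy, sum_gaussianTerm_some,
    Fintype.card_fin] at htail
  simp only [dotProduct_crossMoment_mulVec]
  exact htail

theorem measureReal_lt_norm_crossMoment_le [IsProbabilityMeasure P] (hσw : 0 ≤ σw) (k : Fin T)
    {ε : ℝ} (hε : 0 < ε) (hε2 : ε ≤ 1 / 2) (hN : 2 * (2 * n + p) * Real.log (1 / ε) ≤ N) :
    P.real {ω | 4 * σw * √(N * (2 * n + p) * Real.log (9 / ε)) *
        ‖CFC.sqrt (covZ A B σx σu σw k)‖ < ‖crossMoment A B (x₀ · ω) (u · · ω) (w · · ω) k‖} ≤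
      ε := by
  obtain ⟨D, hdim, hD⟩ : ∃ D : ℕ, n + (n + p) = D ∧ 2 * (n : ℝ) + p = D :=
    ⟨_, rfl, by push_cast; ring⟩
  rw [hD] at hN ⊢
  have hthreshold : 4 * σw * √(N * D * Real.log (9 / ε)) * ‖CFC.sqrt (covZ A B σx σu σw k)‖ =
      σw * ‖CFC.sqrt (covZ A B σx σu σw k)‖ * (9 / 4 * √(N * D * Real.log (9 / ε))) /
        (1 - (1 / 4 : NNReal)) ^ 2 := by
    push_cast
    ring
  rcases eq_or_ne n 0 with rfl | hn
  · have hzero (ω : Ω) : ¬ 4 * σw * √(N * D * Real.log (9 / ε)) *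
        ‖CFC.sqrt (covZ A B σx σu σw k)‖ <
          ‖crossMoment A B (x₀ · ω) (u · · ω) (w · · ω) k‖ := by
      rw [Subsingleton.elim (crossMoment A B _ _ _ _) 0, norm_zero, not_lt]
      positivity
    simpa only [hzero, Set.ofPred_false, measureReal_empty] using hε.le
  obtain ⟨θ, hθ0, hθ1, hθ⟩ := exists_nine_pow_mul_chernoff_le (by omega) hε hε2 hN
  rw [hthreshold]
  refine (measureReal_lt_l2_opNorm_le (by norm_num) (by norm_num) fun x y hx hy ↦
    (measureReal_mono fun ω hω ↦ ?_).trans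
      (measureReal_lt_dotProduct_crossMoment_mulVec_le A B hdata x.ofLp y.ofLp k
        (τ := 9 / 4 * √(N * D * Real.log (9 / ε))) hθ0 hθ1)).trans ?_
  · rw [Set.mem_ofPred_eq] at hω ⊢
    refine lt_of_le_of_lt ?_ hω
    gcongr
    exact sqrt_variance_mul_variance_le A B σx σu hσw k hx hy
  have hnine : 1 + 2 / ((1 / 4 : NNReal) : ℝ) = 9 := by norm_num
  rwa [Fintype.card_sum, Fintype.card_fin, Fintype.card_fin, hdim, hnine]

end Rollouts

section UnionBound

theorem ofReal_one_sub_sum_le_measure_forall {Ω ι : Type*} [MeasurableSpace Ω] [Fintype ι]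
    {P : Measure Ω} [IsProbabilityMeasure P] {p : ι → Ω → Prop} {ε : ι → ℝ}
    (h : ∀ i, P.real {ω | ¬ p i ω} ≤ ε i) :
    ENNReal.ofReal (1 - ∑ i, ε i) ≤ P {ω | ∀ i, p i ω} := by
  have hcompl : {ω | ∀ i, p i ω}ᶜ = ⋃ i, {ω | ¬ p i ω} := by ext; simp
  have hunion : P.real {ω | ∀ i, p i ω}ᶜ ≤ ∑ i, ε i := by
    rw [hcompl]
    exact (measureReal_iUnion_fintype_le _).trans (Finset.sum_le_sum fun i _ ↦ h i)
  have htotal : 1 ≤ P.real {ω | ∀ i, p i ω} + P.real {ω | ∀ i, p i ω}ᶜ := by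
    rw [← probReal_univ (μ := P), ← Set.union_compl_self {ω | ∀ i, p i ω}]
    exact measureReal_union_le _ _
  exact ENNReal.ofReal_le_of_le_toReal (by rw [← Measure.real]; linarith)

end UnionBound

end AuxSysId

theorem proposition3 {n p N T : ℕ}
    {Ω : Type*} [MeasurableSpace Ω] (P : Measure Ω) [IsProbabilityMeasure P]
    (A : ℕ → Matrix (Fin n) (Fin n) ℝ) (B : ℕ → Matrix (Fin n) (Fin p) ℝ)
    (σx σu σw : ℝ) (hσx : 0 ≤ σx) (hσu : 0 ≤ σu) (hσw : 0 ≤ σw)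
    (x₀ : Fin N → Ω → EuclideanSpace ℝ (Fin n))
    (u : Fin N → ℕ → Ω → EuclideanSpace ℝ (Fin p))
    (w : Fin N → ℕ → Ω → EuclideanSpace ℝ (Fin n))
    (hdata : AuxSysId.IsRolloutData P T σx σu σw x₀ u w)
    (q : ℕ → ℝ) (hq : ∀ k < T, 0 ≤ q k)
    (δ : ℝ) (hδ : 0 < δ) (hδT : T = 1 → δ ≤ 1 / 2)
    (hN : (4 * (n : ℝ) + 2 * (p : ℝ)) * Real.log ((T : ℝ) / δ) ≤ (N : ℝ)) :
    ENNReal.ofReal (1 - δ) ≤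
      P {ω | ‖AuxSysId.batchW T (fun i k => w i k ω) * AuxSysId.batchQ N T q *
            (AuxSysId.batchZ T A B (fun i => x₀ i ω) (fun i k => u i k ω)
              (fun i k => w i k ω))ᴴ‖
          ≤ 4 * σw * √((N : ℝ) * (2 * (n : ℝ) + (p : ℝ)) * Real.log (9 * (T : ℝ) / δ)) *
            ∑ k ∈ Finset.range T, q k * ‖CFC.sqrt (AuxSysId.covZ A B σx σu σw k)‖} := by
  rcases le_or_gt 1 δ with hδ1 | hδ1
  · simp [ENNReal.ofReal_of_nonpos (sub_nonpos.2 hδ1)]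
  have hε (k : Fin T) : 0 < δ / T ∧ δ / T ≤ 1 / 2 := by
    have hT : (0 : ℝ) < T := by exact_mod_cast k.pos
    refine ⟨by positivity, (div_le_iff₀ hT).2 ?_⟩
    rcases (Nat.succ_le_of_lt k.pos).eq_or_lt with rfl | hT2
    · simpa using hδT rfl
    · linarith [show (2 : ℝ) ≤ T from mod_cast hT2]
  have hN' : 2 * (2 * n + p) * Real.log (1 / (δ / T)) ≤ N := by
    rw [one_div_div]
    linarith
  have hnorm (k : Fin T) := AuxSysId.measureReal_lt_norm_crossMoment_le A B hdata hσw k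
    (hε k).1 (hε k).2 hN'
  simp only [← not_le] at hnorm
  have hsum : ∑ _k : Fin T, δ / T ≤ δ := by
    rcases eq_or_ne T 0 with rfl | hT
    · simpa using hδ.le
    · simp [mul_div_cancel₀, hT]
  refine (ENNReal.ofReal_le_ofReal (sub_le_sub_left hsum 1)).trans <|
    (AuxSysId.ofReal_one_sub_sum_le_measure_forall hnorm).trans (measure_mono fun ω hω ↦ ?_)
  rw [Set.mem_ofPred_eq, ← div_div_eq_mul_div]
  exact AuxSysId.norm_batchW_mul_batchQ_mul_batchZ_le A B _ _ _ hq hω
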